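/- Let $\alpha_1,\alpha_2,\beta_1,\beta_2>0$, and let $\{X(t):t\ge 0\}$ be a time-homogeneous continuous-time Markov chain on $\mathbb{Z}$ with transition probabilities $p_{k,n}(t)=P(X(t)=n\mid X(0)=k)$, $p_{k,n}(0)=1_{\{k=n\}}$, whose generator $g_{k,n}=\lim_{t\downarrow 0}\frac{p_{k,n}(t)-p_{k,n}(0)}{t}$ is given by $$g_{k,k+1}=\begin{cases}\alpha_1,&k\text{ even}\\ \beta_1,&k\text{ odd}\end{cases},\qquad g_{k,k-1}=\begin{cases}\alpha_2,&k\text{ even}\\ \beta_2,&k\text{ odd}\end{cases},\qquad g_{k,k}=\begin{cases}-(\alpha_1+\alpha_2),&k\text{ even}\\ -(\beta_1+\beta_2),&k\text{ odd}\end{cases},$$ and $g_{k,n}=0$ for $|k-n|\ge 2$. Put, for $z>0$ and $\gamma\in\mathbb{R}$, $$h(z)=\tfrac12\sqrt{(\alpha_1+\alpha_2-(\beta_1+\beta_2))^2z^2+4(\beta_1z^2+\beta_2)(\alpha_1z^2+\alpha_2)},\qquad \Lambda(\gamma)=\frac{h(e^\gamma)}{e^\gamma}-\frac{\alpha_1+\alpha_2+\beta_1+\beta_2}{2},$$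 and $\Lambda^*(y)=\sup_{\gamma\in\mathbb{R}}\{\gamma y-\Lambda(\gamma)\}\in[0,+\infty]$ for $y\in\mathbb{R}$. Then, for every $k\in\mathbb{Z}$ (with $P(X(0)=k)>0$, so that the conditional laws are defined), the family of laws $\pi_t=P\left(\frac{X(t)}{t}\in\cdot\,\Big|\,X(0)=k\right)$, $t>0$, satisfies the large deviation principle on $\mathbb{R}$ with speed function $v_t=t$ and good rate function $\Lambda^*$. That is, $\Lambda^*$ is nonnegative and lower semicontinuous, its level sets $\{y\in\mathbb{R}:\Lambda^*(y)\le\eta\}$, $\eta\ge 0$, are compact, and $$\liminf_{t\to+\infty}\frac1t\log\pi_t(O)\ge-\inf_{y\in O}\Lambda^*(y)\ \text{ for all open } O\subseteq\mathbb{R},\qquad \limsup_{t\to+\infty}\frac1t\log\pi_t(C)\le-\inf_{y\in C}\Lambda^*(y)\ \text{ for all closed } C\subseteq\mathbb{R},$$ with the conventions $\log 0=-\infty$ and $\inf\emptyset=+\infty$. -/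

import Mathlib

open MeasureTheory ProbabilityTheory Filter Topology
open scoped NNReal ENNReal

noncomputable section

/-! ### Large deviation principle -/

/-- The family of laws `π t` (`t > 0`) on a topological space `Y` satisfies the large deviation
principle as `t → ∞` with rate function `I : Y → [0, ∞]` and speed function `v`. All quantities
are extended reals, so that `log 0 = -∞` and the infimum over the empty set is `+∞`. -/
structure LargeDeviationPrinciple {Y : Type*} [TopologicalSpace Y] [MeasurableSpace Y]
    (π : ℝ≥0 → Measure Y) (v : ℝ≥0 → ℝ) (I : Y → EReal) : Prop where
  isProbabilityMeasure : ∀ t, 0 < t → IsProbabilityMeasure (π t)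
  speed_tendsto : Tendsto v atTop atTop
  rate_nonneg : ∀ y, 0 ≤ I y
  rate_lsc : LowerSemicontinuous I
  lower_bound : ∀ O : Set Y, IsOpen O →
    -(⨅ y ∈ O, I y) ≤ liminf (fun t => ((1 / v t : ℝ) : EReal) * ENNReal.log (π t O)) atTop
  upper_bound : ∀ C : Set Y, IsClosed C →
    limsup (fun t => ((1 / v t : ℝ) : EReal) * ENNReal.log (π t C)) atTop ≤ -(⨅ y ∈ C, I y)

/-- A rate function is good if all its level sets are compact. -/
def IsGoodRateFunction {Y : Type*} [TopologicalSpace Y] (I : Y → EReal) : Prop :=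
  ∀ η : ℝ, 0 ≤ η → IsCompact {y | I y ≤ (η : EReal)}

/-- The Legendre transform `y ↦ sup_γ (γ y - L γ)` on the real line, with values in the extended
reals. -/
def legendreTransform (L : ℝ → ℝ) (y : ℝ) : EReal :=
  ⨆ γ : ℝ, ((γ * y - L γ : ℝ) : EReal)

/-! ### Continuous-time Markov chains on the integers -/

/-- `p t k n` is the probability of going from `k` to `n` in time `t`: each `p t` is a stochastic
matrix, `p 0` is the identity matrix, and the Chapman-Kolmogorov equations hold. -/
structure IsTransitionFunction (p : ℝ≥0 → ℤ → ℤ → ℝ) : Prop where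
  nonneg : ∀ t k n, 0 ≤ p t k n
  hasSum_one : ∀ t k, HasSum (fun n => p t k n) 1
  zero : ∀ k n, p 0 k n = if k = n then 1 else 0
  chapman_kolmogorov : ∀ s t k n, HasSum (fun j => p s k j * p t j n) (p (s + t) k n)

/-- The matrix `g` is the generator of `p`: every entry `g k n` is the limit of
`(p t k n - p 0 k n) / t` as `t` decreases to `0`. -/
def HasGenerator (p : ℝ≥0 → ℤ → ℤ → ℝ) (g : ℤ → ℤ → ℝ) : Prop :=
  ∀ k n, Tendsto (fun t : ℝ≥0 => (p t k n - p 0 k n) / (t : ℝ)) (𝓝[>] 0) (𝓝 (g k n))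

/-- Under `P`, the process `X` is a time-homogeneous Markov chain on the integers with transition
function `p` (and arbitrary initial distribution): for times `t 0 < ... < t m`, states
`i 0, ..., i m`, a state `j` and a time lag `s`, the probability that `X (t m + s) = j` given
`X (t 0) = i 0, ..., X (t m) = i m` is `p s (i m) j`. This is written in product form, so that
conditioning events of probability zero impose nothing. -/
structure IsMarkovChain {Ω : Type*} [MeasurableSpace Ω] (P : Measure Ω)
    (X : ℝ≥0 → Ω → ℤ) (p : ℝ≥0 → ℤ → ℤ → ℝ) : Prop where
  measurable : ∀ t, Measurable (X t)
  markov : ∀ (m : ℕ) (t : Fin (m + 1) → ℝ≥0), StrictMono t →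
    ∀ (i : Fin (m + 1) → ℤ) (s : ℝ≥0) (j : ℤ),
      P ({ω | ∀ l, X (t l) ω = i l} ∩ {ω | X (t (Fin.last m) + s) ω = j}) =
        P {ω | ∀ l, X (t l) ω = i l} * ENNReal.ofReal (p s (i (Fin.last m)) j)

/-! ### The chain with alternating rates -/

/-- The generator of the nearest-neighbour chain with alternating rates: from an even state the
rates up and down are `α₁` and `α₂`, from an odd state they are `β₁` and `β₂`. -/
def alternatingGenerator (α₁ α₂ β₁ β₂ : ℝ) (k n : ℤ) : ℝ :=
  if n = k + 1 then (if Even k then α₁ else β₁)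
  else if n = k - 1 then (if Even k then α₂ else β₂)
  else if n = k then (if Even k then -(α₁ + α₂) else -(β₁ + β₂))
  else 0

/-- The function under the square root in the definition of `alternatingH`. -/
def alternatingHTilde (α₁ α₂ β₁ β₂ z : ℝ) : ℝ :=
  (α₁ + α₂ - (β₁ + β₂)) ^ 2 * z ^ 2 + 4 * (β₁ * z ^ 2 + β₂) * (α₁ * z ^ 2 + α₂)

/-- The function `h`. -/
def alternatingH (α₁ α₂ β₁ β₂ z : ℝ) : ℝ :=
  1 / 2 * Real.sqrt (alternatingHTilde α₁ α₂ β₁ β₂ z)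

/-- The function `Λ`, given by `Λ γ = h (e ^ γ) / e ^ γ - (α₁ + α₂ + β₁ + β₂) / 2`. -/
def alternatingLambda (α₁ α₂ β₁ β₂ γ : ℝ) : ℝ :=
  alternatingH α₁ α₂ β₁ β₂ (Real.exp γ) / Real.exp γ - (α₁ + α₂ + β₁ + β₂) / 2

end

/-!
For fixed `γ`, the generator has the positive eigenfunction `n ↦ v(n) e^{γ n}`, where `v` depends
only on the parity of `n` and is the Perron eigenvector of a `2 × 2` matrix with eigenvalue `Λ(γ)`.
Since the generator is conservative with bounded diagonal, comparing with the backward equation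
entry by entry bounds `p` from below by the exponential series of the generator. Both have total
mass one, so they agree. Applied to the eigenfunction, the series gives
`E[v(X(t)) e^{γ X(t)} | X(0) = k] = e^{t Λ(γ)} v(k) e^{γ k}`, so that `Λ` is the limiting scaled
cumulant generating function of `X(t) / t`.

The large deviation principle is then the Gärtner-Ellis theorem. For the upper bound, a closed set
on which `Λ* > a` is covered by finitely many half-lines, and Chebyshev's inequality with the weight
`e^{γ t x}` applies to each of them. For the lower bound, exponential tilting makes the laws
concentrate at a prescribed `y = Λ'(γ)`. Every `y` has this form, because `γ ↦ Λ(γ) - γ y` tends to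
infinity at both ends and so attains its minimum.
-/

/-! ### Logarithms on the exponential scale -/

/-- The logarithm of `u t` divided by `t`, whose limits as `t → ∞` are the exponential rates in a
large deviation principle with speed `t`. -/
noncomputable def scaledLog (u : ℝ≥0 → ℝ≥0∞) (t : ℝ≥0) : EReal :=
  ((1 / (t : ℝ) : ℝ) : EReal) * ENNReal.log (u t)

theorem scaledLog_mono {u v : ℝ≥0 → ℝ≥0∞} {t : ℝ≥0} (h : u t ≤ v t) :
    scaledLog u t ≤ scaledLog v t :=
  mul_le_mul_of_nonneg_left (ENNReal.log_le_log h) (by positivity)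

theorem scaledLog_eq_div (u : ℝ≥0 → ℝ≥0∞) (t : ℝ≥0) :
    scaledLog u t = ENNReal.log (u t) / ((t : ℝ) : EReal) := by
  rw [scaledLog, one_div, EReal.coe_inv, EReal.div_eq_inv_mul]

theorem scaledLog_le_coe_iff {u : ℝ≥0 → ℝ≥0∞} {t : ℝ≥0} (ht : 0 < t) {z : ℝ} :
    scaledLog u t ≤ z ↔ u t ≤ ENNReal.ofReal (Real.exp (t * z)) := by
  have ht' : (0 : EReal) < ((t : ℝ) : EReal) := mod_cast ht
  rw [scaledLog_eq_div, EReal.div_le_iff_le_mul ht' (EReal.coe_ne_top _), ← ENNReal.log_le_log_iff,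
    ENNReal.log_ofReal_of_pos (Real.exp_pos _), Real.log_exp, EReal.coe_mul]

theorem coe_le_scaledLog_iff {u : ℝ≥0 → ℝ≥0∞} {t : ℝ≥0} (ht : 0 < t) {z : ℝ} :
    z ≤ scaledLog u t ↔ ENNReal.ofReal (Real.exp (t * z)) ≤ u t := by
  have ht' : (0 : EReal) < ((t : ℝ) : EReal) := mod_cast ht
  rw [scaledLog_eq_div, EReal.le_div_iff_mul_le ht' (EReal.coe_ne_top _), ← ENNReal.log_le_log_iff,
    ENNReal.log_ofReal_of_pos (Real.exp_pos _), Real.log_exp, EReal.coe_mul, mul_comm]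

theorem limsup_scaledLog_le_iff {u : ℝ≥0 → ℝ≥0∞} {a : EReal} :
    limsup (scaledLog u) atTop ≤ a ↔
      ∀ z : ℝ, a < z → ∀ᶠ t : ℝ≥0 in atTop, u t ≤ ENNReal.ofReal (Real.exp (t * z)) := by
  rw [limsup_le_iff']
  refine ⟨fun h z hz => ?_, fun h y hy => ?_⟩
  · filter_upwards [h z hz, eventually_gt_atTop 0] with t ht ht0
    exact (scaledLog_le_coe_iff ht0).1 ht
  · obtain ⟨z, haz, hzy⟩ := EReal.lt_iff_exists_real_btwn.1 hy
    filter_upwards [h z haz, eventually_gt_atTop 0] with t ht ht0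
    exact ((scaledLog_le_coe_iff ht0).2 ht).trans hzy.le

theorem le_liminf_scaledLog_iff {u : ℝ≥0 → ℝ≥0∞} {a : EReal} :
    a ≤ liminf (scaledLog u) atTop ↔
      ∀ z : ℝ, z < a → ∀ᶠ t : ℝ≥0 in atTop, ENNReal.ofReal (Real.exp (t * z)) ≤ u t := by
  rw [le_liminf_iff']
  refine ⟨fun h z hz => ?_, fun h y hy => ?_⟩
  · filter_upwards [h z hz, eventually_gt_atTop 0] with t ht ht0
    exact (coe_le_scaledLog_iff ht0).1 ht
  · obtain ⟨z, hyz, hza⟩ := EReal.lt_iff_exists_real_btwn.1 hy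
    filter_upwards [h z hza, eventually_gt_atTop 0] with t ht ht0
    exact hyz.le.trans ((coe_le_scaledLog_iff ht0).2 ht)

theorem eventually_ofReal_exp_add_self_le {w z : ℝ} (h : w < z) :
    ∀ᶠ t : ℝ≥0 in atTop, ENNReal.ofReal (Real.exp (t * w)) + ENNReal.ofReal (Real.exp (t * w)) ≤
      ENNReal.ofReal (Real.exp (t * z)) := by
  have hlim : Tendsto (fun t : ℝ≥0 => (t : ℝ) * (z - w)) atTop atTop :=
    (NNReal.tendsto_coe_atTop.2 tendsto_id).atTop_mul_const (sub_pos.2 h)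
  filter_upwards [hlim.eventually_ge_atTop (Real.log 2)] with t ht
  rw [← ENNReal.ofReal_add (Real.exp_pos _).le (Real.exp_pos _).le, ← two_mul,
    ← Real.exp_log two_pos, ← Real.exp_add]
  exact ENNReal.ofReal_le_ofReal (Real.exp_le_exp.2 (by linarith))

theorem limsup_scaledLog_add_le (u v : ℝ≥0 → ℝ≥0∞) :
    limsup (scaledLog (u + v)) atTop ≤
      max (limsup (scaledLog u) atTop) (limsup (scaledLog v) atTop) := by
  refine limsup_scaledLog_le_iff.2 fun z hz => ?_
  obtain ⟨w, hw, hwz⟩ := EReal.lt_iff_exists_real_btwn.1 hz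
  rw [max_lt_iff] at hw
  filter_upwards [limsup_scaledLog_le_iff.1 le_rfl w hw.1, limsup_scaledLog_le_iff.1 le_rfl w hw.2,
    eventually_ofReal_exp_add_self_le (EReal.coe_lt_coe_iff.1 hwz)] with t hu hv ht
  exact (add_le_add hu hv).trans ht

theorem le_liminf_scaledLog_of_add {u v : ℝ≥0 → ℝ≥0∞} {a : EReal}
    (hv : limsup (scaledLog v) atTop < a) (huv : a ≤ liminf (scaledLog (u + v)) atTop) :
    a ≤ liminf (scaledLog u) atTop := by
  refine le_liminf_scaledLog_iff.2 fun z hz => ?_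
  obtain ⟨w, hzw, hwa⟩ := EReal.lt_iff_exists_real_btwn.1 (max_lt hz hv)
  obtain ⟨w', hww', hw'a⟩ := EReal.lt_iff_exists_real_btwn.1 hwa
  rw [max_lt_iff] at hzw
  filter_upwards [limsup_scaledLog_le_iff.1 le_rfl w hzw.2, le_liminf_scaledLog_iff.1 huv w' hw'a,
    eventually_ofReal_exp_add_self_le (EReal.coe_lt_coe_iff.1 hww')] with t hvt huvt hexp
  have hzt : ENNReal.ofReal (Real.exp (t * z)) ≤ ENNReal.ofReal (Real.exp (t * w)) := by
    have := EReal.coe_lt_coe_iff.1 hzw.1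
    gcongr
  exact ENNReal.le_of_add_le_add_right (hvt.trans_lt ENNReal.ofReal_lt_top).ne <|
    (add_le_add hzt hvt).trans (hexp.trans huvt)

theorem tendsto_scaledLog_ofReal_mul_exp {b : ℝ} (hb : 0 < b) (z : ℝ) :
    Tendsto (scaledLog fun t => ENNReal.ofReal (b * Real.exp (t * z))) atTop (𝓝 z) := by
  have hlim : Tendsto (fun t : ℝ≥0 => Real.log b / (t : ℝ) + z) atTop (𝓝 z) := by
    simpa only [zero_add, id] using
      ((NNReal.tendsto_coe_atTop.2 tendsto_id).const_div_atTop (Real.log b)).add_const z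
  refine ((continuous_coe_real_ereal.tendsto z).comp hlim).congr' ?_
  filter_upwards [eventually_gt_atTop 0] with t ht
  have ht' : (t : ℝ) ≠ 0 := mod_cast ht.ne'
  rw [scaledLog, ENNReal.log_ofReal_of_pos (by positivity), ← EReal.coe_mul,
    Real.log_mul hb.ne' (Real.exp_pos _).ne', Real.log_exp, Function.comp_apply]
  congr 1
  field_simp

theorem tendsto_scaledLog_of_le_of_le {u : ℝ≥0 → ℝ≥0∞} {a b z : ℝ} (ha : 0 < a) (hb : 0 < b)
    (hau : ∀ t : ℝ≥0, 0 < t → ENNReal.ofReal (a * Real.exp (t * z)) ≤ u t)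
    (hub : ∀ t : ℝ≥0, 0 < t → u t ≤ ENNReal.ofReal (b * Real.exp (t * z))) :
    Tendsto (scaledLog u) atTop (𝓝 z) :=
  tendsto_of_tendsto_of_tendsto_of_le_of_le' (tendsto_scaledLog_ofReal_mul_exp ha z)
    (tendsto_scaledLog_ofReal_mul_exp hb z)
    ((eventually_gt_atTop 0).mono fun t ht => scaledLog_mono (hau t ht))
    ((eventually_gt_atTop 0).mono fun t ht => scaledLog_mono (hub t ht))

/-! ### The Gärtner-Ellis theorem on the real line -/

/-- `Λ` is the limiting scaled cumulant generating function of the family of measures `π t`: the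
moment generating function of `π t` at `t * γ` grows like `exp (t * Λ γ)` as `t → ∞`. -/
def HasScaledCgf (π : ℝ≥0 → Measure ℝ) (Λ : ℝ → ℝ) : Prop :=
  ∀ γ, Tendsto (scaledLog fun t => ∫⁻ x, ENNReal.ofReal (Real.exp (γ * ((t : ℝ) * x))) ∂π t) atTop
    (𝓝 (Λ γ))

/-- The family of measures obtained from `π` by exponential tilting with parameter `γ`; it is not
normalized. -/
noncomputable def expTilt (π : ℝ≥0 → Measure ℝ) (γ : ℝ) (t : ℝ≥0) : Measure ℝ :=
  (π t).withDensity fun x => ENNReal.ofReal (Real.exp (γ * ((t : ℝ) * x)))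

theorem lintegral_expTilt (π : ℝ≥0 → Measure ℝ) (γ η : ℝ) (t : ℝ≥0) :
    ∫⁻ x, ENNReal.ofReal (Real.exp (η * ((t : ℝ) * x))) ∂expTilt π γ t =
      ∫⁻ x, ENNReal.ofReal (Real.exp ((γ + η) * ((t : ℝ) * x))) ∂π t := by
  rw [expTilt, lintegral_withDensity_eq_lintegral_mul _ (by fun_prop) (by fun_prop)]
  refine lintegral_congr fun x => ?_
  rw [Pi.mul_apply, ← ENNReal.ofReal_mul (Real.exp_pos _).le, ← Real.exp_add, add_mul]

theorem expTilt_ball_le (π : ℝ≥0 → Measure ℝ) (γ y δ : ℝ) (t : ℝ≥0) :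
    expTilt π γ t (Metric.ball y δ) ≤
      ENNReal.ofReal (Real.exp (t * (γ * y + |γ| * δ))) * π t (Metric.ball y δ) := by
  rw [expTilt, withDensity_apply _ measurableSet_ball, ← setLIntegral_const]
  refine setLIntegral_mono (by fun_prop) fun x hx =>
    ENNReal.ofReal_le_ofReal (Real.exp_le_exp.2 ?_)
  have hdist : γ * (x - y) ≤ |γ| * δ :=
    (le_abs_self _).trans <| (abs_mul γ (x - y)).trans_le <|
      mul_le_mul_of_nonneg_left (Metric.mem_ball.1 hx).le (abs_nonneg γ)
  rw [mul_left_comm]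
  exact mul_le_mul_of_nonneg_left (by linarith) t.2

theorem measure_halfLine_le_exp_mul_lintegral (μ : Measure ℝ) (γ s : ℝ) {t : ℝ} (ht : 0 ≤ t) :
    μ {x | s ≤ γ * x} ≤
      ENNReal.ofReal (Real.exp (-(t * s))) *
        ∫⁻ x, ENNReal.ofReal (Real.exp (γ * (t * x))) ∂μ := by
  rw [← lintegral_const_mul _ (by fun_prop), ← setLIntegral_one]
  refine (setLIntegral_mono (by fun_prop) fun x hx => ?_).trans (setLIntegral_le_lintegral _ _)
  rw [← ENNReal.ofReal_mul (Real.exp_pos _).le, ← Real.exp_add, ENNReal.one_le_ofReal,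
    Real.one_le_exp_iff]
  have := mul_le_mul_of_nonneg_left (show s ≤ γ * x from hx) ht
  linarith

theorem exists_pos_sub_lt_of_hasDerivAt {f : ℝ → ℝ} {x y δ : ℝ} (hf : HasDerivAt f y x)
    (hδ : 0 < δ) :
    ∃ η > 0, f (x + η) - f x < η * (y + δ) ∧ f (x - η) - f x < -η * (y - δ) := by
  have hsmall : ∀ᶠ ε in 𝓝 (0 : ℝ), |f (x + ε) - f x - ε * y| ≤ δ / 2 * |ε| := by
    simpa only [smul_eq_mul, Real.norm_eq_abs] using
      (hasDerivAt_iff_isLittleO_nhds_zero.1 hf).def (half_pos hδ)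
  obtain ⟨r, hr, hball⟩ := Metric.eventually_nhds_iff.1 hsmall
  obtain ⟨η, hη, hηr⟩ := exists_between hr
  have hpos := (abs_le.1 (hball (y := η) (by simpa [abs_of_pos hη] using hηr))).2
  have hneg := (abs_le.1 (hball (y := -η) (by simpa [abs_of_pos hη] using hηr))).2
  rw [abs_of_pos hη] at hpos
  rw [abs_neg, abs_of_pos hη, ← sub_eq_add_neg] at hneg
  have := mul_pos hη hδ
  exact ⟨η, hη, by linarith, by linarith⟩

namespace HasScaledCgf

variable {π : ℝ≥0 → Measure ℝ} {Λ : ℝ → ℝ}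

theorem expTilt (h : HasScaledCgf π Λ) (γ : ℝ) :
    HasScaledCgf (expTilt π γ) (fun η => Λ (γ + η)) := fun η => by
  simpa only [lintegral_expTilt] using h (γ + η)

theorem tendsto_measure_univ (h : HasScaledCgf π Λ) :
    Tendsto (scaledLog fun t => π t Set.univ) atTop (𝓝 (Λ 0)) := by
  simpa only [zero_mul, Real.exp_zero, ENNReal.ofReal_one, lintegral_one] using h 0

theorem zero_of_isProbabilityMeasure (h : HasScaledCgf π Λ)
    (hπ : ∀ t, 0 < t → IsProbabilityMeasure (π t)) : Λ 0 = 0 := by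
  refine EReal.coe_eq_coe_iff.1 <| tendsto_nhds_unique_of_eventuallyEq h.tendsto_measure_univ
    tendsto_const_nhds ?_
  filter_upwards [eventually_gt_atTop 0] with t ht
  have := hπ t ht
  rw [scaledLog, measure_univ, ENNReal.log_one, mul_zero, EReal.coe_zero]

theorem limsup_measure_halfLine_le (h : HasScaledCgf π Λ) (γ s : ℝ) :
    limsup (scaledLog fun t => π t {x | s ≤ γ * x}) atTop ≤ (Λ γ - s : ℝ) := by
  refine limsup_scaledLog_le_iff.2 fun z hz => ?_
  have hz' : (Λ γ : EReal) < (z + s : ℝ) :=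
    EReal.coe_lt_coe_iff.2 (sub_lt_iff_lt_add.1 (EReal.coe_lt_coe_iff.1 hz))
  filter_upwards [limsup_scaledLog_le_iff.1 (h γ).limsup_eq.le _ hz'] with t ht
  calc π t {x | s ≤ γ * x}
      ≤ _ := measure_halfLine_le_exp_mul_lintegral (π t) γ s t.2
    _ ≤ ENNReal.ofReal (Real.exp (-(t * s))) * ENNReal.ofReal (Real.exp (t * (z + s))) :=
      mul_le_mul_right ht _
    _ = ENNReal.ofReal (Real.exp (t * z)) := by
      rw [← ENNReal.ofReal_mul (Real.exp_pos _).le, ← Real.exp_add]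
      ring_nf

theorem limsup_measure_isClosed_le (h : HasScaledCgf π Λ) {C : Set ℝ} (hC : IsClosed C) {a : ℝ}
    (ha : ∀ y ∈ C, (a : EReal) < legendreTransform Λ y) :
    limsup (scaledLog fun t => π t C) atTop ≤ (-a : ℝ) := by
  set Q : Set ℝ → Prop := fun S => limsup (scaledLog fun t => π t S) atTop ≤ (-a : ℝ)
  have hmono : ∀ ⦃S T : Set ℝ⦄, S ⊆ T → Q T → Q S := fun S T hST hT =>
    (limsup_le_limsup (.of_forall fun t => scaledLog_mono (measure_mono hST))).trans hT
  have hunion : ∀ ⦃S T : Set ℝ⦄, Q S → Q T → Q (S ∪ T) := fun S T hS hT =>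
    (limsup_le_limsup (.of_forall fun t => scaledLog_mono (measure_union_le S T))).trans <|
      (limsup_scaledLog_add_le _ _).trans (max_le hS hT)
  have hhalf : ∀ γ, Q {x | a + Λ γ ≤ γ * x} := fun γ => by
    simpa only [Q, sub_add_cancel_right] using h.limsup_measure_halfLine_le γ (a + Λ γ)
  have hempty : Q ∅ := hmono (Set.empty_subset _) (hhalf 0)
  have hcompact : Q (C ∩ Set.Icc (-(a + Λ (-1))) (a + Λ 1)) := by
    refine (isCompact_Icc.inter_left hC).induction_on hempty hmono hunion fun y hy => ?_
    obtain ⟨γ, hγ⟩ := lt_iSup_iff.1 (ha y hy.1)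
    have hopen : IsOpen {x | a + Λ γ < γ * x} := isOpen_lt (by fun_prop) (by fun_prop)
    exact ⟨_, mem_nhdsWithin_of_mem_nhds (hopen.mem_nhds
      (lt_sub_iff_add_lt.1 (EReal.coe_lt_coe_iff.1 hγ))),
      hmono (fun x (hx : a + Λ γ < γ * x) => hx.le) (hhalf γ)⟩
  refine hmono (fun y hy => ?_) (hunion hcompact (hunion (hhalf 1) (hhalf (-1))))
  simp only [Set.mem_union, Set.mem_inter_iff, Set.mem_Icc, Set.mem_ofPred_eq]
  grind

theorem limsup_measure_compl_ball_lt (h : HasScaledCgf π Λ) {y δ : ℝ} (hδ : 0 < δ)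
    (hy : HasDerivAt Λ y 0) :
    limsup (scaledLog fun t => π t (Metric.ball y δ)ᶜ) atTop < Λ 0 := by
  obtain ⟨η, hη, hpos, hneg⟩ := exists_pos_sub_lt_of_hasDerivAt hy hδ
  rw [zero_add] at hpos
  rw [zero_sub] at hneg
  have hcover : (Metric.ball y δ)ᶜ ⊆
      {x | η * (y + δ) ≤ η * x} ∪ {x | -η * (y - δ) ≤ -η * x} := fun x hx => by
    rw [Set.mem_compl_iff, Metric.mem_ball, Real.dist_eq, abs_lt, not_and_or] at hx
    simp only [Set.mem_union, Set.mem_ofPred_eq, neg_mul, neg_le_neg_iff, mul_le_mul_iff_right₀ hη]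
    grind
  calc limsup (scaledLog fun t => π t (Metric.ball y δ)ᶜ) atTop
      ≤ limsup (scaledLog ((fun t => π t {x | η * (y + δ) ≤ η * x}) +
          fun t => π t {x | -η * (y - δ) ≤ -η * x})) atTop :=
        limsup_le_limsup <| .of_forall fun t =>
          scaledLog_mono ((measure_mono hcover).trans (measure_union_le _ _))
    _ ≤ max (Λ η - η * (y + δ) : ℝ) (Λ (-η) - -η * (y - δ) : ℝ) :=
        (limsup_scaledLog_add_le _ _).trans <|
          max_le_max (h.limsup_measure_halfLine_le _ _) (h.limsup_measure_halfLine_le _ _)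
    _ < Λ 0 := max_lt (EReal.coe_lt_coe_iff.2 (sub_lt_comm.1 hpos))
        (EReal.coe_lt_coe_iff.2 (sub_lt_comm.1 hneg))

theorem le_liminf_measure_ball_of_hasDerivAt_zero (h : HasScaledCgf π Λ) {y δ : ℝ} (hδ : 0 < δ)
    (hy : HasDerivAt Λ y 0) :
    Λ 0 ≤ liminf (scaledLog fun t => π t (Metric.ball y δ)) atTop := by
  refine le_liminf_scaledLog_of_add (h.limsup_measure_compl_ball_lt hδ hy) ?_
  simpa only [Pi.add_def, measure_add_measure_compl measurableSet_ball] using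
    h.tendsto_measure_univ.liminf_eq.ge

theorem le_liminf_measure_ball (h : HasScaledCgf π Λ) {γ y δ : ℝ} (hδ : 0 < δ)
    (hγ : HasDerivAt Λ y γ) :
    (Λ γ - (γ * y + |γ| * δ) : ℝ) ≤ liminf (scaledLog fun t => π t (Metric.ball y δ)) atTop := by
  have hderiv : HasDerivAt (fun η => Λ (γ + η)) y 0 :=
    HasDerivAt.comp_const_add γ 0 (by rwa [add_zero])
  have htilt := (h.expTilt γ).le_liminf_measure_ball_of_hasDerivAt_zero hδ hderiv
  rw [add_zero] at htilt
  refine le_liminf_scaledLog_iff.2 fun z hz => ?_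
  have hz' : ((z + (γ * y + |γ| * δ) : ℝ) : EReal) < Λ γ :=
    EReal.coe_lt_coe_iff.2 (lt_sub_iff_add_lt.1 (EReal.coe_lt_coe_iff.1 hz))
  filter_upwards [le_liminf_scaledLog_iff.1 htilt _ hz'] with t ht
  have hle := ht.trans (expTilt_ball_le π γ y δ t)
  rw [mul_add, Real.exp_add, mul_comm, ENNReal.ofReal_mul (Real.exp_pos _).le] at hle
  exact (ENNReal.mul_le_mul_iff_right (ENNReal.ofReal_pos.2 (Real.exp_pos _)).ne'
    ENNReal.ofReal_ne_top).1 hle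

theorem le_liminf_measure_isOpen (h : HasScaledCgf π Λ) {γ y : ℝ} (hγ : HasDerivAt Λ y γ)
    {O : Set ℝ} (hO : IsOpen O) (hy : y ∈ O) :
    (Λ γ - γ * y : ℝ) ≤ liminf (scaledLog fun t => π t O) atTop := by
  obtain ⟨r, hr, hrO⟩ := Metric.isOpen_iff.1 hO y hy
  have hlim : Tendsto (fun δ => ((Λ γ - (γ * y + |γ| * δ) : ℝ) : EReal)) (𝓝[>] 0)
      (𝓝 (Λ γ - γ * y : ℝ)) := by
    have hcont : Continuous fun δ => ((Λ γ - (γ * y + |γ| * δ) : ℝ) : EReal) :=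
      continuous_coe_real_ereal.comp (by fun_prop)
    simpa only [mul_zero, add_zero] using (hcont.tendsto 0).mono_left nhdsWithin_le_nhds
  refine le_of_tendsto hlim ?_
  filter_upwards [Ioo_mem_nhdsGT hr] with δ hδ
  exact (h.le_liminf_measure_ball hδ.1 hγ).trans <| liminf_le_liminf <| .of_forall fun t =>
    scaledLog_mono (measure_mono ((Metric.ball_subset_ball hδ.2.le).trans hrO))

end HasScaledCgf

theorem lowerSemicontinuous_legendreTransform (Λ : ℝ → ℝ) :
    LowerSemicontinuous (legendreTransform Λ) :=
  lowerSemicontinuous_iSup fun _ =>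
    (continuous_coe_real_ereal.comp (by fun_prop)).lowerSemicontinuous

theorem le_legendreTransform (Λ : ℝ → ℝ) (γ y : ℝ) :
    ((γ * y - Λ γ : ℝ) : EReal) ≤ legendreTransform Λ y :=
  le_iSup (fun γ : ℝ => ((γ * y - Λ γ : ℝ) : EReal)) γ

theorem isGoodRateFunction_legendreTransform (Λ : ℝ → ℝ) :
    IsGoodRateFunction (legendreTransform Λ) := by
  intro η _
  refine (isCompact_Icc (a := -(η + Λ (-1))) (b := η + Λ 1)).of_isClosed_subset
    ((lowerSemicontinuous_legendreTransform Λ).isClosed_preimage η) fun y hy => ?_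
  have hpos := EReal.coe_le_coe_iff.1 ((le_legendreTransform Λ 1 y).trans hy)
  have hneg := EReal.coe_le_coe_iff.1 ((le_legendreTransform Λ (-1) y).trans hy)
  constructor <;> linarith

theorem HasScaledCgf.largeDeviationPrinciple {π : ℝ≥0 → Measure ℝ} {Λ : ℝ → ℝ}
    (h : HasScaledCgf π Λ) (hπ : ∀ t, 0 < t → IsProbabilityMeasure (π t))
    (hΛ : ∀ y, ∃ γ, HasDerivAt Λ y γ) :
    LargeDeviationPrinciple π (fun t => (t : ℝ)) (legendreTransform Λ) where
  isProbabilityMeasure := hπ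
  speed_tendsto := NNReal.tendsto_coe_atTop.2 tendsto_id
  rate_nonneg y := by
    simpa only [zero_mul, h.zero_of_isProbabilityMeasure hπ, sub_zero, EReal.coe_zero] using
      le_legendreTransform Λ 0 y
  rate_lsc := lowerSemicontinuous_legendreTransform Λ
  lower_bound O hO := by
    refine EReal.neg_le_of_neg_le (le_iInf₂ fun y hy => EReal.neg_le_of_neg_le ?_)
    obtain ⟨γ, hγ⟩ := hΛ y
    refine (EReal.neg_le_neg_iff.2 (le_legendreTransform Λ γ y)).trans ?_
    rw [← EReal.coe_neg, neg_sub]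
    exact h.le_liminf_measure_isOpen hγ hO hy
  upper_bound C hC := by
    refine EReal.le_neg_of_le_neg (EReal.ge_of_forall_gt_iff_ge.1 fun a ha => ?_)
    refine EReal.le_neg_of_le_neg ?_
    rw [← EReal.coe_neg]
    exact h.limsup_measure_isClosed_le hC fun y hy => ha.trans_le (iInf₂_le y hy)

theorem exists_hasDerivAt_of_tendsto_cocompact {f : ℝ → ℝ} (hf : Differentiable ℝ f) {y : ℝ}
    (hy : Tendsto (fun x => f x - x * y) (cocompact ℝ) atTop) : ∃ x, HasDerivAt f y x := by
  obtain ⟨x, hx⟩ := (hf.continuous.sub (by fun_prop)).exists_forall_le hy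
  have hderiv := (hf x).hasDerivAt.sub ((hasDerivAt_id x).mul_const y)
  have hzero := IsLocalMin.hasDerivAt_eq_zero (.of_forall hx) hderiv
  rw [one_mul, sub_eq_zero] at hzero
  exact ⟨x, hzero ▸ (hf x).hasDerivAt⟩

/-! ### Exponential series of locally finite monotone operators -/

theorem hasDerivAt_sum_range_pow_div_factorial_mul (a : ℕ → ℝ) (M : ℕ) (x : ℝ) :
    HasDerivAt (fun x : ℝ => ∑ m ∈ Finset.range (M + 1), x ^ m / m.factorial * a m)
      (∑ m ∈ Finset.range M, x ^ m / m.factorial * a (m + 1)) x := by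
  simp only [Finset.sum_range_succ' _ M, pow_zero]
  refine (HasDerivAt.fun_sum fun m _ => HasDerivAt.mul_const ?_ _).add_const _
  refine ((hasDerivAt_pow (m + 1) x).div_const _).congr_deriv ?_
  rw [Nat.factorial_succ, Nat.cast_mul, add_tsub_cancel_right]
  field_simp

section Operator

variable {ι : Type*}

theorem sum_range_pow_div_factorial_mul_le {A : Module.End ℝ (ι → ℝ)} (hA : Monotone A)
    {u : ℝ → ι → ℝ} (hu : ∀ x, 0 ≤ x → 0 ≤ u x) (hcont : ∀ k, Continuous fun x => u x k)
    (hderiv : ∀ x, 0 ≤ x → ∀ k, HasDerivWithinAt (fun y => u y k) (A (u x) k) (Set.Ici x) x)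
    (M : ℕ) {x : ℝ} (hx : 0 ≤ x) (k : ι) :
    ∑ m ∈ Finset.range M, x ^ m / m.factorial * (A ^ m) (u 0) k ≤ u x k := by
  induction M generalizing x k with
  | zero => exact hu x hx k
  | succ M ih =>
    have hsum := hasDerivAt_sum_range_pow_div_factorial_mul (fun m => (A ^ m) (u 0) k) M
    refine image_le_of_deriv_right_le_deriv_boundary (b := x)
      (fun y _ => (hsum y).continuousAt.continuousWithinAt)
      (fun y _ => (hsum y).hasDerivWithinAt) ?_ (hcont k).continuousOn
      (fun y hy => hderiv y hy.1 k) (fun y hy => ?_) (Set.right_mem_Icc.2 hx)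
    · simp [Finset.sum_range_succ']
    · have hpartial : ∑ m ∈ Finset.range M, (y ^ m / m.factorial) • (A ^ m) (u 0) ≤ u y :=
        fun j => by
          simpa only [Finset.sum_apply, Pi.smul_apply, smul_eq_mul] using ih hy.1 j
      simpa only [map_sum, map_smul, ← Module.End.mul_apply, ← pow_succ', Finset.sum_apply,
        Pi.smul_apply, smul_eq_mul] using hA hpartial k

/-- The operator `f ↦ g f` for a matrix `g` whose `k`-th row is supported in the finite set `N k`;
only the entries `g k j` with `j ∈ N k` enter. -/
noncomputable def generatorEnd (N : ι → Finset ι) (g : ι → ι → ℝ) : Module.End ℝ (ι → ℝ) :=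
  LinearMap.pi fun k => ∑ j ∈ N k, g k j • LinearMap.proj j

theorem generatorEnd_apply (N : ι → Finset ι) (g : ι → ι → ℝ) (f : ι → ℝ) (k : ι) :
    generatorEnd N g f k = ∑ j ∈ N k, g k j * f j := by
  simp only [generatorEnd, LinearMap.pi_apply, LinearMap.sum_apply, LinearMap.smul_apply,
    LinearMap.proj_apply, smul_eq_mul]

/-- The shift `g + c` of a generator `g`. When `-c` bounds the diagonal of `g` from below, its
matrix is nonnegative and `exp (t * g) = exp (-c * t) * exp (t * (g + c))` is a series with
nonnegative terms. -/
noncomputable def uniformization (N : ι → Finset ι) (g : ι → ι → ℝ) (c : ℝ) :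
    Module.End ℝ (ι → ℝ) :=
  generatorEnd N g + c • 1

variable {N : ι → Finset ι} {g : ι → ι → ℝ} {c : ℝ}

theorem uniformization_apply (f : ι → ℝ) (k : ι) :
    uniformization N g c f k = ∑ j ∈ N k, g k j * f j + c * f k := by
  simp only [uniformization, LinearMap.add_apply, LinearMap.smul_apply, Module.End.one_apply,
    Pi.add_apply, Pi.smul_apply, generatorEnd_apply, smul_eq_mul]

theorem monotone_uniformization (hN : ∀ k, k ∈ N k) (hg : ∀ k j, j ≠ k → 0 ≤ g k j)
    (hc : ∀ k, -c ≤ g k k) : Monotone (uniformization N g c) := fun f₁ f₂ hf k => by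
  classical
  have hoff : ∑ j ∈ (N k).erase k, g k j * f₁ j ≤ ∑ j ∈ (N k).erase k, g k j * f₂ j :=
    Finset.sum_le_sum fun j hj =>
      mul_le_mul_of_nonneg_left (hf j) (hg k j (Finset.ne_of_mem_erase hj))
  have hdiag : (g k k + c) * f₁ k ≤ (g k k + c) * f₂ k :=
    mul_le_mul_of_nonneg_left (hf k) (neg_le_iff_add_nonneg.1 (hc k))
  rw [uniformization_apply, uniformization_apply, ← Finset.add_sum_erase _ _ (hN k),
    ← Finset.add_sum_erase _ _ (hN k)]
  linarith

theorem hasSum_uniformization_pow [DecidableEq ι] (m : ℕ) (f : ι → ℝ) (k : ι) :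
    HasSum (fun n => (uniformization N g c ^ m) (Pi.single n 1) k * f n)
      ((uniformization N g c ^ m) f k) := by
  induction m generalizing k with
  | zero =>
    simpa using hasSum_single (f := fun n => (Pi.single n 1 : ι → ℝ) k * f n) k
      fun n hn => by rw [Pi.single_eq_of_ne' hn, zero_mul]
  | succ m ih =>
    have hsum := (hasSum_sum fun j (_ : j ∈ N k) => (ih j).mul_left (g k j)).add
      ((ih k).mul_left c)
    simp only [pow_succ', Module.End.mul_apply, uniformization_apply, add_mul, Finset.sum_mul,
      mul_assoc]
    exact hsum

theorem pow_apply_eq_smul {R M : Type*} [CommSemiring R] [AddCommMonoid M] [Module R M]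
    {A : Module.End R M} {r : R} {v : M} (h : A v = r • v) (m : ℕ) : (A ^ m) v = r ^ m • v := by
  induction m with
  | zero => rw [pow_zero, pow_zero, one_smul, Module.End.one_apply]
  | succ m ih => rw [pow_succ', Module.End.mul_apply, ih, map_smul, h, smul_smul, pow_succ]

theorem hasSum_pow_div_factorial_mul_pow_apply {A : Module.End ℝ (ι → ℝ)} {f : ι → ℝ} {r : ℝ}
    (h : A f = r • f) (x : ℝ) (k : ι) :
    HasSum (fun m : ℕ => x ^ m / m.factorial * (A ^ m) f k) (Real.exp (r * x) * f k) := by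
  rw [Real.exp_eq_exp_ℝ]
  convert! (NormedSpace.expSeries_div_hasSum_exp (r * x)).mul_right (f k) using 2 with m
  rw [pow_apply_eq_smul h, Pi.smul_apply, smul_eq_mul, mul_pow]
  ring

theorem pow_apply_nonneg_of_monotone {A : Module.End ℝ (ι → ℝ)} (hA : Monotone A) {f : ι → ℝ}
    (hf : 0 ≤ f) (m : ℕ) : 0 ≤ (A ^ m) f := by
  rw [Module.End.pow_apply, ← map_zero (A ^ m), Module.End.pow_apply]
  exact hA.iterate m hf

/-- The entry in position `(k, n)` of the matrix `exp (x * A)`, as a series in `[0, ∞]`; it is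
meaningful when `0 ≤ x` and `A` preserves nonnegativity. -/
noncomputable def expEntry [DecidableEq ι] (A : Module.End ℝ (ι → ℝ)) (x : ℝ) (k n : ι) : ℝ≥0∞ :=
  ∑' m : ℕ, ENNReal.ofReal (x ^ m / m.factorial * (A ^ m) (Pi.single n 1) k)

theorem tsum_expEntry_uniformization_mul [DecidableEq ι] (hmono : Monotone (uniformization N g c))
    {f : ι → ℝ} {l : ℝ} (hf : 0 ≤ f) (hl : generatorEnd N g f = l • f) {x : ℝ} (hx : 0 ≤ x)
    (k : ι) :
    ∑' n, expEntry (uniformization N g c) x k n * ENNReal.ofReal (f n) =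
      ENNReal.ofReal (Real.exp ((l + c) * x) * f k) := by
  set U := uniformization N g c
  have hU : U f = (l + c) • f := by
    rw [add_smul, ← hl]
    rfl
  have hcoef : ∀ m n, 0 ≤ x ^ m / m.factorial * (U ^ m) (Pi.single n 1) k := fun m n =>
    mul_nonneg (by positivity)
      (pow_apply_nonneg_of_monotone hmono (Pi.single_nonneg.2 zero_le_one) m k)
  have hrow : ∀ m : ℕ, ∑' n, ENNReal.ofReal
      (x ^ m / m.factorial * (U ^ m) (Pi.single n 1) k * f n) =
        ENNReal.ofReal (x ^ m / m.factorial * (U ^ m) f k) := fun m => by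
    have hsum := (hasSum_uniformization_pow (N := N) (g := g) (c := c) m f k).mul_left
      (x ^ m / (m.factorial : ℝ))
    simp only [← mul_assoc] at hsum
    rw [← ENNReal.ofReal_tsum_of_nonneg (fun n => mul_nonneg (hcoef m n) (hf n)) hsum.summable,
      hsum.tsum_eq]
  have hexp := hasSum_pow_div_factorial_mul_pow_apply hU x k
  simp only [expEntry, ← ENNReal.tsum_mul_right, ← ENNReal.ofReal_mul (hcoef _ _)]
  rw [ENNReal.tsum_comm, tsum_congr hrow, ← ENNReal.ofReal_tsum_of_nonneg (fun m => ?_)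
    hexp.summable, hexp.tsum_eq]
  exact mul_nonneg (by positivity) (pow_apply_nonneg_of_monotone hmono hf m k)

end Operator

/-! ### Transition functions with a conservative generator -/

/-- Each row `k` of the matrix `g` sums to zero over the finite set `N k`, which contains `k`. For
the generator of a transition function this forces the other entries of the row to vanish, so that
`N k` contains all states reached from `k` in one jump. -/
structure IsConservativeOn {ι : Type*} (N : ι → Finset ι) (g : ι → ι → ℝ) : Prop where
  mem_self : ∀ k, k ∈ N k
  sum_eq_zero : ∀ k, ∑ j ∈ N k, g k j = 0

namespace IsTransitionFunction

variable {p : ℝ≥0 → ℤ → ℤ → ℝ} {g : ℤ → ℤ → ℝ}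

theorem le_one (hp : IsTransitionFunction p) (t : ℝ≥0) (k n : ℤ) : p t k n ≤ 1 :=
  le_hasSum (hp.hasSum_one t k) n fun j _ => hp.nonneg t k j

theorem sum_mul_le_add (hp : IsTransitionFunction p) (S : Finset ℤ) (s t : ℝ≥0) (k n : ℤ) :
    ∑ j ∈ S, p s k j * p t j n ≤ p (s + t) k n :=
  sum_le_hasSum S (fun j _ => mul_nonneg (hp.nonneg s k j) (hp.nonneg t j n))
    (hp.chapman_kolmogorov s t k n)

theorem add_le_sum_mul_add (hp : IsTransitionFunction p) (S : Finset ℤ) (s t : ℝ≥0) (k n : ℤ) :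
    p (s + t) k n ≤ ∑ j ∈ S, p s k j * p t j n + (1 - ∑ j ∈ S, p s k j) := by
  have hle := sum_le_hasSum S
    (fun j _ => sub_nonneg.2 (mul_le_of_le_one_right (hp.nonneg s k j) (hp.le_one t j n)))
    ((hp.hasSum_one s k).sub (hp.chapman_kolmogorov s t k n))
  rw [Finset.sum_sub_distrib] at hle
  linarith

theorem abs_add_sub_le (hp : IsTransitionFunction p) (s t : ℝ≥0) (k n : ℤ) :
    |p (s + t) k n - p t k n| ≤ 1 - p s k k := by
  have hlower := hp.sum_mul_le_add {k} s t k n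
  have hupper := hp.add_le_sum_mul_add {k} s t k n
  rw [Finset.sum_singleton] at hlower hupper
  rw [Finset.sum_singleton] at hupper
  have hle := mul_le_of_le_one_left (hp.nonneg t k n) (hp.le_one s k k)
  have hge := mul_nonneg (sub_nonneg.2 (hp.le_one s k k)) (sub_nonneg.2 (hp.le_one t k n))
  exact abs_le.2 ⟨by linarith, by linarith⟩

theorem nonneg_of_ne (hp : IsTransitionFunction p) (hg : HasGenerator p g) {k n : ℤ}
    (hn : n ≠ k) : 0 ≤ g k n := by
  refine ge_of_tendsto (hg k n) (.of_forall fun t => div_nonneg ?_ t.2)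
  rw [hp.zero, if_neg hn.symm, sub_zero]
  exact hp.nonneg t k n

theorem tendsto_diag_one (hp : IsTransitionFunction p) (hg : HasGenerator p g) (k : ℤ) :
    Tendsto (fun s => p s k k) (𝓝 0) (𝓝 1) := by
  have hcoe : Tendsto (fun t : ℝ≥0 => (t : ℝ)) (𝓝[>] 0) (𝓝 0) :=
    (NNReal.continuous_coe.tendsto' 0 0 NNReal.coe_zero).mono_left nhdsWithin_le_nhds
  have hlim : Tendsto (fun s => p s k k) (𝓝[>] 0) (𝓝 (p 0 k k)) := by
    have hprod := ((hg k k).mul hcoe).add_const (p 0 k k)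
    rw [mul_zero, zero_add] at hprod
    refine hprod.congr' ?_
    filter_upwards [self_mem_nhdsWithin] with t ht
    rw [div_mul_cancel₀ _ (NNReal.coe_ne_zero.2 (ne_of_gt ht)), sub_add_cancel]
  have huniv : insert (0 : ℝ≥0) (Set.Ioi 0) = Set.univ := by
    ext x
    simp
  have hcont := ContinuousWithinAt.insert (f := fun s => p s k k) hlim
  rw [huniv, continuousWithinAt_univ, ContinuousAt, hp.zero, if_pos rfl] at hcont
  exact hcont

theorem dist_le (hp : IsTransitionFunction p) (s t : ℝ≥0) (k n : ℤ) :
    dist (p s k n) (p t k n) ≤ 1 - p (nndist s t) k k := by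
  wlog hst : t ≤ s generalizing s t
  · rw [dist_comm, nndist_comm]
    exact this t s (le_of_not_ge hst)
  have hdist : nndist s t = s - t := by
    rw [NNReal.nndist_eq, tsub_eq_zero_of_le hst, max_eq_left zero_le]
  have hle := hp.abs_add_sub_le (s - t) t k n
  rwa [tsub_add_cancel_of_le hst, ← Real.dist_eq, ← hdist] at hle

theorem continuous (hp : IsTransitionFunction p) (hg : HasGenerator p g) (k n : ℤ) :
    Continuous fun t => p t k n := by
  refine continuous_iff_continuousAt.2 fun t => tendsto_iff_dist_tendsto_zero.2 ?_
  have hnndist : Tendsto (fun s : ℝ≥0 => nndist s t) (𝓝 t) (𝓝 0) :=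
    (continuous_id.nndist continuous_const).tendsto' t 0 (nndist_self t)
  have hdiag := ((hp.tendsto_diag_one hg k).comp hnndist).const_sub 1
  rw [sub_self] at hdiag
  exact squeeze_zero (fun _ => dist_nonneg) (fun s => hp.dist_le s t k n) hdiag

theorem tendsto_sum_mul_sub_div (hp : IsTransitionFunction p) (hg : HasGenerator p g)
    {S : Finset ℤ} {k : ℤ} (hk : k ∈ S) (f : ℤ → ℝ) :
    Tendsto (fun s : ℝ≥0 => (∑ j ∈ S, p s k j * f j - f k) / (s : ℝ)) (𝓝[>] 0)
      (𝓝 (∑ j ∈ S, g k j * f j)) := by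
  refine (tendsto_finsetSum S fun j _ => (hg k j).mul_const (f j)).congr fun s => ?_
  have hzero : ∑ j ∈ S, p 0 k j * f j = f k := by
    simp only [hp.zero, ite_mul, one_mul, zero_mul, Finset.sum_ite_eq, if_pos hk]
  rw [← hzero, ← Finset.sum_sub_distrib, Finset.sum_div]
  exact Finset.sum_congr rfl fun j _ => by ring

variable {N : ℤ → Finset ℤ}

theorem tendsto_add_sub_div (hp : IsTransitionFunction p) (hg : HasGenerator p g)
    (hN : IsConservativeOn N g) (t : ℝ≥0) (k n : ℤ) :
    Tendsto (fun s : ℝ≥0 => (p (s + t) k n - p t k n) / (s : ℝ)) (𝓝[>] 0)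
      (𝓝 (∑ j ∈ N k, g k j * p t j n)) := by
  have hlower := hp.tendsto_sum_mul_sub_div hg (hN.mem_self k) fun j => p t j n
  have hescape := hp.tendsto_sum_mul_sub_div hg (hN.mem_self k) fun _ => 1
  simp only [mul_one, hN.sum_eq_zero] at hescape
  have hupper := hlower.sub hescape
  rw [sub_zero] at hupper
  refine tendsto_of_tendsto_of_tendsto_of_le_of_le hlower hupper (fun s => ?_) fun s => ?_
  · exact div_le_div_of_nonneg_right
      (sub_le_sub_right (hp.sum_mul_le_add (N k) s t k n) _) s.2
  · rw [← sub_div]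
    refine div_le_div_of_nonneg_right ?_ s.2
    linarith [hp.add_le_sum_mul_add (N k) s t k n]

theorem hasDerivWithinAt_toNNReal (hp : IsTransitionFunction p) (hg : HasGenerator p g)
    (hN : IsConservativeOn N g) {x : ℝ} (hx : 0 ≤ x) (k n : ℤ) :
    HasDerivWithinAt (fun y : ℝ => p y.toNNReal k n) (∑ j ∈ N k, g k j * p x.toNNReal j n)
      (Set.Ici x) x := by
  have hshift : Tendsto (fun y : ℝ => (y - x).toNNReal) (𝓝[>] x) (𝓝[>] 0) := by
    have hcont : Continuous fun y : ℝ => (y - x).toNNReal := by fun_prop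
    refine tendsto_nhdsWithin_iff.2
      ⟨(hcont.tendsto' x 0 (by simp)).mono_left nhdsWithin_le_nhds, ?_⟩
    filter_upwards [self_mem_nhdsWithin] with y hy
    exact Real.toNNReal_pos.2 (sub_pos.2 hy)
  rw [hasDerivWithinAt_iff_tendsto_slope, Set.Ici_sdiff_left]
  refine ((hp.tendsto_add_sub_div hg hN x.toNNReal k n).comp hshift).congr' ?_
  filter_upwards [self_mem_nhdsWithin] with y hy
  have hxy : 0 ≤ y - x := sub_nonneg.2 (le_of_lt hy)
  rw [Function.comp_apply, ← Real.toNNReal_add hxy hx, sub_add_cancel, Real.coe_toNNReal _ hxy,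
    slope_def_field]

variable {c : ℝ}

theorem expEntry_uniformization_le (hp : IsTransitionFunction p) (hg : HasGenerator p g)
    (hN : IsConservativeOn N g) (hc : ∀ k, -c ≤ g k k) (t : ℝ≥0) (k n : ℤ) :
    expEntry (uniformization N g c) t k n ≤ ENNReal.ofReal (Real.exp (c * t) * p t k n) := by
  set u : ℝ → ℤ → ℝ := fun x k => Real.exp (c * x) * p x.toNNReal k n
  have hu : ∀ x, 0 ≤ x → 0 ≤ u x := fun x _ k => mul_nonneg (Real.exp_pos _).le (hp.nonneg _ k n)
  have hu0 : u 0 = Pi.single n 1 := by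
    ext j
    simp [u, hp.zero, Pi.single_apply]
  have hcont : ∀ k, Continuous fun x => u x k := fun k =>
    (by fun_prop : Continuous fun x => Real.exp (c * x)).mul
      ((hp.continuous hg k n).comp continuous_real_toNNReal)
  have hderiv : ∀ x, 0 ≤ x → ∀ k,
      HasDerivWithinAt (fun y => u y k) (uniformization N g c (u x) k) (Set.Ici x) x := by
    intro x hx k
    have hexp := ((hasDerivAt_id x).const_mul c).exp.hasDerivWithinAt (s := Set.Ici x)
    refine (hexp.mul (hp.hasDerivWithinAt_toNNReal hg hN hx k n)).congr_deriv ?_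
    simp only [uniformization_apply, u, mul_left_comm (g k _), ← Finset.mul_sum, id]
    ring
  have hmono := monotone_uniformization hN.mem_self (fun k j => hp.nonneg_of_ne hg) hc
  refine ENNReal.tsum_le_of_sum_range_le fun M => ?_
  rw [← ENNReal.ofReal_sum_of_nonneg fun m _ => mul_nonneg (by positivity)
    (pow_apply_nonneg_of_monotone hmono (Pi.single_nonneg.2 zero_le_one) m k), ← hu0]
  refine ENNReal.ofReal_le_ofReal ?_
  simpa only [u, Real.toNNReal_coe] using
    sum_range_pow_div_factorial_mul_le hmono hu hcont hderiv M t.coe_nonneg k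

theorem expEntry_uniformization_eq (hp : IsTransitionFunction p) (hg : HasGenerator p g)
    (hN : IsConservativeOn N g) (hc : ∀ k, -c ≤ g k k) (t : ℝ≥0) (k n : ℤ) :
    expEntry (uniformization N g c) t k n = ENNReal.ofReal (Real.exp (c * t) * p t k n) := by
  have hmono := monotone_uniformization hN.mem_self (fun k j => hp.nonneg_of_ne hg) hc
  have hle := hp.expEntry_uniformization_le hg hN hc t k
  have hmass : ∑' n, expEntry (uniformization N g c) t k n =
      ENNReal.ofReal (Real.exp (c * t)) := by
    have hone : generatorEnd N g 1 = (0 : ℝ) • 1 := by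
      ext k
      simpa [generatorEnd_apply] using hN.sum_eq_zero k
    simpa using tsum_expEntry_uniformization_mul hmono zero_le_one hone t.coe_nonneg k
  have hmass' : ∑' n, ENNReal.ofReal (Real.exp (c * t) * p t k n) =
      ENNReal.ofReal (Real.exp (c * t)) := by
    have hsum := (hp.hasSum_one t k).mul_left (Real.exp (c * t))
    rw [← ENNReal.ofReal_tsum_of_nonneg
      (fun n => mul_nonneg (Real.exp_pos _).le (hp.nonneg t k n)) hsum.summable, hsum.tsum_eq,
      mul_one]
  refine (hle n).eq_of_not_lt fun hlt => ?_
  have := ENNReal.tsum_lt_tsum (hmass ▸ ENNReal.ofReal_ne_top) hle hlt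
  exact this.ne (hmass.trans hmass'.symm)

theorem tsum_mul_eigenfunction (hp : IsTransitionFunction p) (hg : HasGenerator p g)
    (hN : IsConservativeOn N g) (hc : ∀ k, -c ≤ g k k) {f : ℤ → ℝ} {l : ℝ} (hf : 0 ≤ f)
    (hl : generatorEnd N g f = l • f) (t : ℝ≥0) (k : ℤ) :
    ∑' n, ENNReal.ofReal (p t k n) * ENNReal.ofReal (f n) =
      ENNReal.ofReal (Real.exp (l * t) * f k) := by
  have hmono := monotone_uniformization hN.mem_self (fun k j => hp.nonneg_of_ne hg) hc
  have hsum := tsum_expEntry_uniformization_mul hmono hf hl t.coe_nonneg k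
  simp only [hp.expEntry_uniformization_eq hg hN hc, ENNReal.ofReal_mul (Real.exp_pos _).le,
    mul_assoc, add_mul, Real.exp_add, ENNReal.tsum_mul_left, mul_comm (Real.exp (l * t))] at hsum
  rw [mul_comm (Real.exp (l * t))]
  exact (ENNReal.mul_right_inj (ENNReal.ofReal_pos.2 (Real.exp_pos _)).ne'
    ENNReal.ofReal_ne_top).1 hsum

end IsTransitionFunction

/-! ### The principal eigenvalue of the alternating chain -/

/-- The exponential moment at `γ` of the jumps `±1` of a walk on `ℤ` with rate `a` up and rate `b`
down. -/
noncomputable def jumpMgf (a b γ : ℝ) : ℝ :=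
  a * Real.exp γ + b * Real.exp (-γ)

theorem jumpMgf_pos {a b : ℝ} (ha : 0 < a) (hb : 0 < b) (γ : ℝ) : 0 < jumpMgf a b γ := by
  unfold jumpMgf
  positivity

theorem min_mul_exp_abs_le_jumpMgf {a b : ℝ} (ha : 0 ≤ a) (hb : 0 ≤ b) (γ : ℝ) :
    min a b * Real.exp |γ| ≤ jumpMgf a b γ :=
  calc min a b * Real.exp |γ| ≤ min a b * (Real.exp γ + Real.exp (-γ)) :=
        mul_le_mul_of_nonneg_left (Real.exp_abs_le γ) (le_min ha hb)
    _ = min a b * Real.exp γ + min a b * Real.exp (-γ) := mul_add _ _ _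
    _ ≤ jumpMgf a b γ := by
        unfold jumpMgf
        gcongr
        exacts [min_le_left a b, min_le_right a b]

theorem tsum_mul_ofReal_le_ofReal_mul_tsum {ι : Type*} {w : ι → ℝ≥0∞} {f₁ f₂ : ι → ℝ} {b : ℝ}
    (hb : 0 ≤ b) (h : ∀ n, f₁ n ≤ b * f₂ n) :
    ∑' n, w n * ENNReal.ofReal (f₁ n) ≤
      ENNReal.ofReal b * ∑' n, w n * ENNReal.ofReal (f₂ n) := by
  rw [← ENNReal.tsum_mul_left]
  refine ENNReal.tsum_le_tsum fun n => ?_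
  rw [mul_left_comm, ← ENNReal.ofReal_mul hb]
  gcongr
  exact h n

section AlternatingChain

variable {α₁ α₂ β₁ β₂ : ℝ}

theorem alternatingLambda_eq (α₁ α₂ β₁ β₂ γ : ℝ) :
    alternatingLambda α₁ α₂ β₁ β₂ γ =
      √((α₁ + α₂ - (β₁ + β₂)) ^ 2 + 4 * (jumpMgf β₁ β₂ γ * jumpMgf α₁ α₂ γ)) / 2 -
        (α₁ + α₂ + β₁ + β₂) / 2 := by
  have hexp := Real.exp_pos γ
  have htilde : alternatingHTilde α₁ α₂ β₁ β₂ (Real.exp γ) =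
      ((α₁ + α₂ - (β₁ + β₂)) ^ 2 + 4 * (jumpMgf β₁ β₂ γ * jumpMgf α₁ α₂ γ)) *
        Real.exp γ ^ 2 := by
    unfold alternatingHTilde jumpMgf
    rw [Real.exp_neg]
    field_simp
  rw [alternatingLambda, alternatingH, htilde, Real.sqrt_mul' _ (sq_nonneg _),
    Real.sqrt_sq hexp.le, ← mul_assoc, mul_div_cancel_right₀ _ hexp.ne', one_div_mul_eq_div]

theorem differentiable_alternatingLambda (hα₁ : 0 < α₁) (hα₂ : 0 < α₂) (hβ₁ : 0 < β₁)
    (hβ₂ : 0 < β₂) : Differentiable ℝ (alternatingLambda α₁ α₂ β₁ β₂) := by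
  have hdisc : ∀ γ, (α₁ + α₂ - (β₁ + β₂)) ^ 2 + 4 * (jumpMgf β₁ β₂ γ * jumpMgf α₁ α₂ γ) ≠ 0 :=
    fun γ => by
      have := jumpMgf_pos hα₁ hα₂ γ
      have := jumpMgf_pos hβ₁ hβ₂ γ
      positivity
  rw [funext (alternatingLambda_eq α₁ α₂ β₁ β₂)]
  refine (Differentiable.div_const (Differentiable.sqrt ?_ hdisc) 2).sub_const _
  unfold jumpMgf
  fun_prop

theorem alternatingLambda_characteristic_equation (hα₁ : 0 < α₁) (hα₂ : 0 < α₂) (hβ₁ : 0 < β₁)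
    (hβ₂ : 0 < β₂) (γ : ℝ) :
    (alternatingLambda α₁ α₂ β₁ β₂ γ + (α₁ + α₂)) * (alternatingLambda α₁ α₂ β₁ β₂ γ + (β₁ + β₂)) =
      jumpMgf β₁ β₂ γ * jumpMgf α₁ α₂ γ := by
  have hD := mul_pos (jumpMgf_pos hβ₁ hβ₂ γ) (jumpMgf_pos hα₁ hα₂ γ)
  have hsq := Real.sq_sqrt (add_nonneg (sq_nonneg (α₁ + α₂ - (β₁ + β₂))) (by linarith [hD] :
    0 ≤ 4 * (jumpMgf β₁ β₂ γ * jumpMgf α₁ α₂ γ)))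
  rw [alternatingLambda_eq]
  linarith

theorem alternatingLambda_add_pos (hα₁ : 0 < α₁) (hα₂ : 0 < α₂) (hβ₁ : 0 < β₁) (hβ₂ : 0 < β₂)
    (γ : ℝ) : 0 < alternatingLambda α₁ α₂ β₁ β₂ γ + (α₁ + α₂) := by
  have hD := mul_pos (jumpMgf_pos hβ₁ hβ₂ γ) (jumpMgf_pos hα₁ hα₂ γ)
  have hlt := Real.sqrt_lt_sqrt (sq_nonneg (α₁ + α₂ - (β₁ + β₂)))
    (lt_add_of_pos_right _ (mul_pos four_pos hD))
  rw [Real.sqrt_sq_eq_abs] at hlt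
  rw [alternatingLambda_eq]
  linarith [neg_abs_le (α₁ + α₂ - (β₁ + β₂))]

theorem mul_exp_abs_sub_le_alternatingLambda (hα₁ : 0 < α₁) (hα₂ : 0 < α₂) (hβ₁ : 0 < β₁)
    (hβ₂ : 0 < β₂) (γ : ℝ) :
    √(min β₁ β₂ * min α₁ α₂) * Real.exp |γ| - (α₁ + α₂ + β₁ + β₂) / 2 ≤
      alternatingLambda α₁ α₂ β₁ β₂ γ := by
  have hα := le_min hα₁.le hα₂.le
  have hβ := le_min hβ₁.le hβ₂.le
  have hprod := mul_le_mul (min_mul_exp_abs_le_jumpMgf hβ₁.le hβ₂.le γ)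
    (min_mul_exp_abs_le_jumpMgf hα₁.le hα₂.le γ) (by positivity) (jumpMgf_pos hβ₁ hβ₂ γ).le
  have hsqrt : 2 * (√(min β₁ β₂ * min α₁ α₂) * Real.exp |γ|) ≤
      √((α₁ + α₂ - (β₁ + β₂)) ^ 2 + 4 * (jumpMgf β₁ β₂ γ * jumpMgf α₁ α₂ γ)) := by
    refine Real.le_sqrt_of_sq_le ?_
    rw [mul_pow, mul_pow, Real.sq_sqrt (mul_nonneg hβ hα)]
    linarith [sq_nonneg (α₁ + α₂ - (β₁ + β₂))]
  rw [alternatingLambda_eq]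
  linarith

theorem tendsto_alternatingLambda_sub_cocompact (hα₁ : 0 < α₁) (hα₂ : 0 < α₂) (hβ₁ : 0 < β₁)
    (hβ₂ : 0 < β₂) (y : ℝ) :
    Tendsto (fun γ => alternatingLambda α₁ α₂ β₁ β₂ γ - γ * y) (cocompact ℝ) atTop := by
  set c := √(min β₁ β₂ * min α₁ α₂)
  have hc : 0 < c := Real.sqrt_pos.2 (mul_pos (lt_min hβ₁ hβ₂) (lt_min hα₁ hα₂))
  have hquad : Tendsto (fun x : ℝ => x * (c / 2 * x - |y|) - (α₁ + α₂ + β₁ + β₂) / 2)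
      atTop atTop :=
    tendsto_atTop_add_const_right _ _ (tendsto_id.atTop_mul_atTop₀
      (tendsto_atTop_add_const_right _ _ (tendsto_id.const_mul_atTop (half_pos hc))))
  refine tendsto_atTop_mono (fun γ => ?_) (hquad.comp (tendsto_norm_cocompact_atTop (E := ℝ)))
  have hexp : |γ| ^ 2 / 2 ≤ Real.exp |γ| := by
    linarith [Real.quadratic_le_exp_of_nonneg (abs_nonneg γ), abs_nonneg γ]
  have hlin := le_abs_self (γ * y)
  rw [abs_mul] at hlin
  have hle := mul_exp_abs_sub_le_alternatingLambda hα₁ hα₂ hβ₁ hβ₂ γ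
  have := mul_le_mul_of_nonneg_left hexp hc.le
  simp only [Function.comp, Real.norm_eq_abs]
  linarith

/-- The states that the nearest-neighbour chain can occupy after at most one jump from `k`. -/
def closedNeighbours (k : ℤ) : Finset ℤ :=
  {k + 1, k - 1, k}

theorem sum_closedNeighbours_alternatingGenerator_mul (f : ℤ → ℝ) (k : ℤ) :
    ∑ j ∈ closedNeighbours k, alternatingGenerator α₁ α₂ β₁ β₂ k j * f j =
      if Even k then α₁ * f (k + 1) + α₂ * f (k - 1) - (α₁ + α₂) * f k
      else β₁ * f (k + 1) + β₂ * f (k - 1) - (β₁ + β₂) * f k := by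
  have hup : k + 1 ∉ ({k - 1, k} : Finset ℤ) := by
    simp only [Finset.mem_insert, Finset.mem_singleton]
    omega
  have hdown : k - 1 ∉ ({k} : Finset ℤ) := by simp
  have hdu : k - 1 ≠ k + 1 := by omega
  have hku : k ≠ k + 1 := by omega
  have hkd : k ≠ k - 1 := by omega
  rw [closedNeighbours, Finset.sum_insert hup, Finset.sum_insert hdown, Finset.sum_singleton]
  simp only [alternatingGenerator, hdu, hku, hkd, if_true, if_false]
  split_ifs <;> ring

theorem isConservativeOn_alternatingGenerator (α₁ α₂ β₁ β₂ : ℝ) :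
    IsConservativeOn closedNeighbours (alternatingGenerator α₁ α₂ β₁ β₂) where
  mem_self k := by simp [closedNeighbours]
  sum_eq_zero k := by
    simpa using sum_closedNeighbours_alternatingGenerator_mul (fun _ => 1) k

theorem neg_sum_rates_le_alternatingGenerator_diag (hα₁ : 0 < α₁) (hα₂ : 0 < α₂) (hβ₁ : 0 < β₁)
    (hβ₂ : 0 < β₂) (k : ℤ) :
    -(α₁ + α₂ + β₁ + β₂) ≤ alternatingGenerator α₁ α₂ β₁ β₂ k k := by
  rw [alternatingGenerator, if_neg (by omega), if_neg (by omega), if_pos rfl]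
  split_ifs <;> linarith

/-- The positive eigenfunction of the alternating generator for the eigenvalue `Λ γ`. Its
parity-dependent factor is an eigenvector of the matrix
`!![-(α₁ + α₂), jumpMgf α₁ α₂ γ; jumpMgf β₁ β₂ γ, -(β₁ + β₂)]`. -/
noncomputable def alternatingEigenfunction (α₁ α₂ β₁ β₂ γ : ℝ) (n : ℤ) : ℝ :=
  (if Even n then jumpMgf α₁ α₂ γ else alternatingLambda α₁ α₂ β₁ β₂ γ + (α₁ + α₂)) *
    Real.exp (γ * n)

theorem generatorEnd_alternatingEigenfunction (hα₁ : 0 < α₁) (hα₂ : 0 < α₂) (hβ₁ : 0 < β₁)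
    (hβ₂ : 0 < β₂) (γ : ℝ) :
    generatorEnd closedNeighbours (alternatingGenerator α₁ α₂ β₁ β₂)
        (alternatingEigenfunction α₁ α₂ β₁ β₂ γ) =
      alternatingLambda α₁ α₂ β₁ β₂ γ • alternatingEigenfunction α₁ α₂ β₁ β₂ γ := by
  ext k
  have hup : Real.exp (γ * (k + 1 : ℤ)) = Real.exp (γ * k) * Real.exp γ := by
    rw [← Real.exp_add, Int.cast_add, Int.cast_one, mul_add, mul_one]
  have hdown : Real.exp (γ * (k - 1 : ℤ)) = Real.exp (γ * k) * Real.exp (-γ) := by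
    rw [← Real.exp_add, Int.cast_sub, Int.cast_one, mul_sub, mul_one, sub_eq_add_neg]
  have heq := alternatingLambda_characteristic_equation hα₁ hα₂ hβ₁ hβ₂ γ
  rw [generatorEnd_apply, sum_closedNeighbours_alternatingGenerator_mul, Pi.smul_apply,
    smul_eq_mul]
  simp only [alternatingEigenfunction, hup, hdown, Int.even_add_one, Int.even_sub_one]
  split_ifs with hk
  · unfold jumpMgf
    ring
  · unfold jumpMgf at heq ⊢
    linear_combination (-Real.exp (γ * k)) * heq

theorem exists_alternatingEigenfunction_bounds (hα₁ : 0 < α₁) (hα₂ : 0 < α₂) (hβ₁ : 0 < β₁)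
    (hβ₂ : 0 < β₂) (γ : ℝ) : ∃ a b : ℝ, 0 < a ∧ 0 < b ∧ ∀ n : ℤ,
      a * Real.exp (γ * n) ≤ alternatingEigenfunction α₁ α₂ β₁ β₂ γ n ∧
      alternatingEigenfunction α₁ α₂ β₁ β₂ γ n ≤ b * Real.exp (γ * n) := by
  have heven := jumpMgf_pos hα₁ hα₂ γ
  have hodd := alternatingLambda_add_pos hα₁ hα₂ hβ₁ hβ₂ γ
  refine ⟨_, _, lt_min heven hodd, (lt_min heven hodd).trans_le min_le_max, fun n => ?_⟩
  unfold alternatingEigenfunction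
  constructor <;> gcongr <;> split_ifs
  exacts [min_le_left _ _, min_le_right _ _, le_max_left _ _, le_max_right _ _]

theorem tendsto_scaledLog_tsum_mul_exp (hα₁ : 0 < α₁) (hα₂ : 0 < α₂) (hβ₁ : 0 < β₁) (hβ₂ : 0 < β₂)
    {p : ℝ≥0 → ℤ → ℤ → ℝ} (hp : IsTransitionFunction p)
    (hg : HasGenerator p (alternatingGenerator α₁ α₂ β₁ β₂)) (k : ℤ) (γ : ℝ) :
    Tendsto (scaledLog fun t =>
        ∑' n : ℤ, ENNReal.ofReal (p t k n) * ENNReal.ofReal (Real.exp (γ * n)))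
      atTop (𝓝 (alternatingLambda α₁ α₂ β₁ β₂ γ : EReal)) := by
  obtain ⟨a, b, ha, hb, hab⟩ := exists_alternatingEigenfunction_bounds hα₁ hα₂ hβ₁ hβ₂ γ
  set f := alternatingEigenfunction α₁ α₂ β₁ β₂ γ
  have hf : ∀ n, 0 < f n := fun n => (mul_pos ha (Real.exp_pos _)).trans_le (hab n).1
  have hsum : ∀ t : ℝ≥0, ∑' n, ENNReal.ofReal (p t k n) * ENNReal.ofReal (f n) =
      ENNReal.ofReal (f k * Real.exp (t * alternatingLambda α₁ α₂ β₁ β₂ γ)) := fun t => by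
    rw [mul_comm (f k), mul_comm (t : ℝ)]
    exact hp.tsum_mul_eigenfunction hg (isConservativeOn_alternatingGenerator α₁ α₂ β₁ β₂)
      (neg_sum_rates_le_alternatingGenerator_diag hα₁ hα₂ hβ₁ hβ₂) (fun n => (hf n).le)
      (generatorEnd_alternatingEigenfunction hα₁ hα₂ hβ₁ hβ₂ γ) t k
  refine tendsto_scaledLog_of_le_of_le (div_pos (hf k) hb) (mul_pos (inv_pos.2 ha) (hf k))
    (fun t _ => ?_) fun t _ => ?_
  · rw [div_mul_eq_mul_div, ENNReal.ofReal_div_of_pos hb, ← hsum]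
    exact ENNReal.div_le_of_le_mul'
      (tsum_mul_ofReal_le_ofReal_mul_tsum hb.le fun n => (hab n).2)
  · rw [mul_assoc, ENNReal.ofReal_mul (inv_pos.2 ha).le, ← hsum]
    exact tsum_mul_ofReal_le_ofReal_mul_tsum (inv_pos.2 ha).le
      fun n => (le_inv_mul_iff₀ ha).2 (hab n).1

end AlternatingChain

/-! ### Conditional laws of the chain -/

namespace IsMarkovChain

variable {Ω : Type*} [MeasurableSpace Ω] {P : Measure Ω} {X : ℝ≥0 → Ω → ℤ}
  {p : ℝ≥0 → ℤ → ℤ → ℝ} {k : ℤ}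

theorem measurable_div (hX : IsMarkovChain P X p) (t : ℝ≥0) :
    Measurable fun ω => (X t ω : ℝ) / (t : ℝ) :=
  (measurable_of_countable fun n : ℤ => (n : ℝ) / (t : ℝ)).comp (hX.measurable t)

variable [IsProbabilityMeasure P]

theorem cond_apply_eq (hX : IsMarkovChain P X p) (hk : P {ω | X 0 ω = k} ≠ 0) (t : ℝ≥0) (n : ℤ) :
    ProbabilityTheory.cond P {ω | X 0 ω = k} {ω | X t ω = n} = ENNReal.ofReal (p t k n) := by
  have hmeas : MeasurableSet {ω | X 0 ω = k} := hX.measurable 0 (measurableSet_singleton k)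
  have hmarkov := hX.markov 0 (fun _ => 0) (Subsingleton.strictMono (α := Fin 1) _) (fun _ => k) t n
  simp only [forall_const, zero_add] at hmarkov
  rw [ProbabilityTheory.cond_apply hmeas, hmarkov, ← mul_assoc,
    ENNReal.inv_mul_cancel hk (measure_ne_top _ _), one_mul]

theorem lintegral_cond_comp (hX : IsMarkovChain P X p) (hk : P {ω | X 0 ω = k} ≠ 0) (t : ℝ≥0)
    (F : ℤ → ℝ≥0∞) :
    ∫⁻ ω, F (X t ω) ∂ProbabilityTheory.cond P {ω | X 0 ω = k} =
      ∑' n, ENNReal.ofReal (p t k n) * F n := by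
  rw [← lintegral_map (measurable_of_countable F) (hX.measurable t), lintegral_countable']
  refine tsum_congr fun n => ?_
  rw [Measure.map_apply (hX.measurable t) (measurableSet_singleton n), ← hX.cond_apply_eq hk t n,
    mul_comm]
  rfl

theorem lintegral_exp_map_div (hX : IsMarkovChain P X p) (hk : P {ω | X 0 ω = k} ≠ 0) {t : ℝ≥0}
    (ht : 0 < t) (γ : ℝ) :
    ∫⁻ x, ENNReal.ofReal (Real.exp (γ * ((t : ℝ) * x)))
        ∂(ProbabilityTheory.cond P {ω | X 0 ω = k}).map (fun ω => (X t ω : ℝ) / (t : ℝ)) =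
      ∑' n : ℤ, ENNReal.ofReal (p t k n) * ENNReal.ofReal (Real.exp (γ * n)) := by
  rw [lintegral_map (by fun_prop) (hX.measurable_div t)]
  simp only [mul_div_cancel₀ _ (NNReal.coe_ne_zero.2 ht.ne')]
  exact hX.lintegral_cond_comp hk t fun n => ENNReal.ofReal (Real.exp (γ * n))

end IsMarkovChain

theorem proposition3p2 {Ω : Type*} [MeasurableSpace Ω] (P : Measure Ω) [IsProbabilityMeasure P]
    (α₁ α₂ β₁ β₂ : ℝ) (hα₁ : 0 < α₁) (hα₂ : 0 < α₂) (hβ₁ : 0 < β₁) (hβ₂ : 0 < β₂)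
    (p : ℝ≥0 → ℤ → ℤ → ℝ) (hp : IsTransitionFunction p)
    (hg : HasGenerator p (alternatingGenerator α₁ α₂ β₁ β₂))
    (X : ℝ≥0 → Ω → ℤ) (hX : IsMarkovChain P X p)
    (k : ℤ) (hk : P {ω | X 0 ω = k} ≠ 0) :
    LargeDeviationPrinciple
        (fun t => (ProbabilityTheory.cond P {ω | X 0 ω = k}).map
          (fun ω => (X t ω : ℝ) / (t : ℝ)))
        (fun t => (t : ℝ))
        (legendreTransform (alternatingLambda α₁ α₂ β₁ β₂)) ∧
      IsGoodRateFunction (legendreTransform (alternatingLambda α₁ α₂ β₁ β₂)) := by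
  refine ⟨HasScaledCgf.largeDeviationPrinciple (fun γ => ?_) (fun t _ => ?_) fun y => ?_,
    isGoodRateFunction_legendreTransform _⟩
  · refine (tendsto_scaledLog_tsum_mul_exp hα₁ hα₂ hβ₁ hβ₂ hp hg k γ).congr' ?_
    filter_upwards [eventually_gt_atTop 0] with t ht
    rw [scaledLog, scaledLog, hX.lintegral_exp_map_div hk ht]
  · have := ProbabilityTheory.cond_isProbabilityMeasure hk
    exact Measure.isProbabilityMeasure_map (hX.measurable_div t).aemeasurable
  · exact exists_hasDerivAt_of_tendsto_cocompact
      (differentiable_alternatingLambda hα₁ hα₂ hβ₁ hβ₂)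
      (tendsto_alternatingLambda_sub_cocompact hα₁ hα₂ hβ₁ hβ₂ y)
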